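/- Let $\mathbb T$ be the unit circle with normalized arclength, and let $H^1$ be the subspace of all $f\in L^1(\mathbb T)$ whose Fourier coefficients with negative index vanish, with the norm $\|f\|_1$ of $L^1(\mathbb T)$. For $f\in H^1$ write $f(z)=\sum_{n\ge 0}a_nz^n$, where $a_n$ is the $n$-th Fourier coefficient of $f$. Let $\ell^2_+$ be the space of square-summable complex sequences indexed by $n\ge 0$, with norm $\|\cdot\|_2$. Let $X$ be the space of all complex sequences $c=(c_n)_{n\ge 0}$ with $$\|c\|^2=\sup_{n\ge 0}\frac{1}{n+1}\sum_{k=0}^n (k+1)^2|c_k|^2<\infty .$$ For $c\in X$ and a real number $A$, say that the generalized Hardy inequality holds for $c$ with constant $A$ if $$\sum_{n=0}^\infty |a_nc_n|\le A\,\|c\|\,\|f\|_1\qquad\text{for all } f(z)=\sum_{n\ge 0}a_nz^n\in H^1 .$$ For a real number $B$, say that the generalized Hilbert inequality holds for $c$ with constant $B$ if $$\sum_{n,m=0}^\infty |a_n||b_m||c_{n+m}|\le B\,\|c\|\,\|(a_n)\|_2\,\|(b_n)\|_2\qquad\text{for all } (a_n),(b_n)\in \ell^2_+ .$$ Convergence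 of the series on the left is part of each inequality. **Theorem 3.5.** For each $c\in X$, the generalized Hardy inequality holds for $c$ with some constant if and only if the generalized Hilbert inequality holds for $c$ with some constant; moreover, for every real $C$, one holds with the constant $C$ if and only if the other does. There are a least constant $A\ge 0$ in the generalized Hardy inequality for $c$ and a least constant $B\ge 0$ in the generalized Hilbert inequality for $c$, and $A=B$. Likewise, there are a least constant $A\ge 0$ with which the generalized Hardy inequality holds for all $c\in X$ simultaneously and a least constant $B\ge 0$ with which the generalized Hilbert inequality holds for all $c\in X$ simultaneously, and $A=B$. -/

import Mathlib

open MeasureTheory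
open scoped ENNReal

noncomputable section

instance factTwoPiPos : Fact (0 < 2 * Real.pi) := ⟨Real.two_pi_pos⟩

/-- The Lebesgue space `L^p` of the unit circle, parametrized by the angle modulo `2π`
and taken with respect to the normalized arclength `dθ / 2π`. -/
abbrev CircleLp (p : ℝ≥0∞) : Type :=
  Lp ℂ p (AddCircle.haarAddCircle (T := 2 * Real.pi))

theorem CircleLp.integrable {p : ℝ≥0∞} [hp : Fact (1 ≤ p)] (f : CircleLp p) :
    Integrable (f : AddCircle (2 * Real.pi) → ℂ) AddCircle.haarAddCircle :=
  (Lp.memLp f).integrable hp.out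

/-- The `n`-th Fourier coefficient `(1/2π) ∫ f(e^{iθ}) e^{-inθ} dθ`. For `n ≥ 0` and `f` in a
Hardy space this is the coefficient `a_n` of the expansion `f(z) = ∑ a_n z^n`. -/
def coeff {p : ℝ≥0∞} (f : CircleLp p) (n : ℤ) : ℂ :=
  fourierCoeff (f : AddCircle (2 * Real.pi) → ℂ) n

theorem fourierMul_integrable {p : ℝ≥0∞} [Fact (1 ≤ p)] (f : CircleLp p) (n : ℤ) :
    Integrable (fun t : AddCircle (2 * Real.pi) => fourier n t • f t)
      AddCircle.haarAddCircle := by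
  have h := (CircleLp.integrable f).bdd_smul (φ := fun t => (fourier n t : ℂ)) 1
    (fourier n).continuous.aestronglyMeasurable
    (Filter.Eventually.of_forall fun t => by rw [fourier_apply, Circle.norm_coe])
  exact h

theorem coeff_add {p : ℝ≥0∞} [Fact (1 ≤ p)] (f g : CircleLp p) (n : ℤ) :
    coeff (f + g) n = coeff f n + coeff g n := by
  unfold coeff fourierCoeff
  rw [← integral_add (fourierMul_integrable f (-n)) (fourierMul_integrable g (-n))]
  refine integral_congr_ae ?_
  filter_upwards [Lp.coeFn_add f g] with t ht
  rw [ht, Pi.add_apply, smul_add]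

theorem coeff_smul {p : ℝ≥0∞} (a : ℂ) (f : CircleLp p) (n : ℤ) :
    coeff (a • f) n = a * coeff f n := by
  unfold coeff fourierCoeff
  rw [← integral_const_mul]
  refine integral_congr_ae ?_
  filter_upwards [Lp.coeFn_smul a f] with t ht
  rw [ht, Pi.smul_apply]
  simp only [smul_eq_mul]
  ring

/-- The Hardy space `H^p`: all `f` in `L^p` of the circle whose negative Fourier coefficients
vanish, with the norm of `L^p`. -/
def HardySpace (p : ℝ≥0∞) [Fact (1 ≤ p)] : Submodule ℂ (CircleLp p) where
  carrier := {f | ∀ n : ℤ, n < 0 → coeff f n = 0}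
  add_mem' := by
    intro f g hf hg n hn
    rw [coeff_add, hf n hn, hg n hn, add_zero]
  zero_mem' := by
    intro n _
    have h := coeff_smul (p := p) 0 0 n
    rwa [zero_smul, zero_mul] at h
  smul_mem' := by
    intro a f hf n hn
    rw [coeff_smul, hf n hn, mul_zero]

/-- The averages `(∑_{k=0}^n (k+1)^2 |c_k|^2) / (n+1)`. -/
def xAverage (c : ℕ → ℂ) (n : ℕ) : ℝ :=
  (∑ k ∈ Finset.range (n + 1), ((k : ℝ) + 1) ^ 2 * ‖c k‖ ^ 2) / ((n : ℝ) + 1)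

/-- The set `X` of all complex sequences whose averages `xAverage` are bounded. -/
def SpaceX : Set (ℕ → ℂ) := {c | BddAbove (Set.range (xAverage c))}

/-- The norm of `X`: the square root of the supremum of the averages. -/
def xNorm (c : ℕ → ℂ) : ℝ := Real.sqrt (⨆ n, xAverage c n)

/-- The generalized Hardy inequality for the sequence `c` with the constant `A`:
`∑ |a_n c_n| ≤ A ‖c‖ ‖f‖_1` for all `f(z) = ∑ a_n z^n` in `H^1`. -/
def HardyInequality (c : ℕ → ℂ) (A : ℝ) : Prop :=
  ∀ f ∈ HardySpace 1,
    Summable (fun n : ℕ => ‖coeff f n * c n‖) ∧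
      ∑' n : ℕ, ‖coeff f n * c n‖ ≤ A * xNorm c * ‖f‖

/-- The generalized Hilbert inequality for the sequence `c` with the constant `B`:
`∑_{n,m} |a_n| |b_m| |c_{n+m}| ≤ B ‖c‖ ‖a‖_2 ‖b‖_2` for all `a`, `b` in `ℓ^2`. -/
def HilbertInequality (c : ℕ → ℂ) (B : ℝ) : Prop :=
  ∀ a b : lp (fun _ : ℕ => ℂ) 2,
    Summable (fun q : ℕ × ℕ => ‖a q.1‖ * ‖b q.2‖ * ‖c (q.1 + q.2)‖) ∧
      ∑' q : ℕ × ℕ, ‖a q.1‖ * ‖b q.2‖ * ‖c (q.1 + q.2)‖ ≤ B * xNorm c * ‖a‖ * ‖b‖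

end

/-!
The two inequalities are the same inequality read through the factorization `H^1 = H^2 · H^2`.

If the Hardy inequality holds and `a`, `b` are square summable, let `g` and `h` have the Taylor
coefficients `|a_n|` and `|b_n|`. The `n`-th coefficient of `gh` is the sum of `|a_k| |b_m|` over
`k + m = n`, so the Hilbert double sum is the Hardy sum of `gh`, and
`‖gh‖_1 ≤ ‖g‖_2 ‖h‖_2 = ‖a‖ ‖b‖` (`HardyInequality.hilbertInequality`). It is enough to do this
for finite sections, where `g` and `h` are polynomials.

Conversely, a nonzero polynomial `p` has a Riesz factorization `p = B F` in the disc, with a Blaschke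
product `B` and a polynomial `F = G²` without zeros in the open disc (`hasRieszFactorization`), and
`|F| = |p|` on the circle. Hence `p = (B G) G`, where on circles of radius `r < 1` both factors have
square integral at most that of `|F|`, which tends to `‖p‖_1` as `r → 1`. The Hilbert inequality for
the coefficients of the factors gives the Hardy inequality for `p` with the same constant
(`HilbertInequality.sum_polynomial_le`). A general `f ∈ H^1` is approached by its Fejér means: they
are polynomials, their `L^1` norms do not exceed `‖f‖_1`, and their coefficients tend to those of
`f` (`HilbertInequality.hardyInequality`).

The admissible constants thus coincide. They form a closed set, so a least one exists as soon as
there is one at all. The Hilbert inequality holds for every `c ∈ X` with the constant `2√6`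
(`hilbertInequality_of_mem_spaceX`): by symmetry only the half `m ≤ n` of the double sum matters,
and it is bounded by a Schur test with the weight `((n + 1) (m + 1))^{-1/2}`. One factor is a sum of
`(m + 1)^{-1/2}` over `m ≤ n`; the other is the tail of `∑ |c_k|² (k + 1)^{1/2}`, bounded by
summation by parts from the averages that define `X`.
-/

open AddCircle

/-! ### Absolutely convergent power series on the circle -/

/-- The boundary function `t ↦ ∑ A_n e^{int}` of the power series with coefficients `A`, with
`fourier 1 t = e^{it}` as the point of the circle. It is used for absolutely summable `A` only. -/
noncomputable def circleSeries (A : ℕ → ℂ) (t : AddCircle (2 * Real.pi)) : ℂ :=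
  ∑' n, A n * fourier 1 t ^ n

theorem norm_fourier_one_apply (t : AddCircle (2 * Real.pi)) : ‖(fourier 1 t : ℂ)‖ = 1 := by
  rw [fourier_one, Circle.norm_coe]

theorem fourier_natCast_apply (n : ℕ) (t : AddCircle (2 * Real.pi)) :
    (fourier (n : ℤ) t : ℂ) = fourier 1 t ^ n := by
  induction n with
  | zero => simp
  | succ n ih => rw [Nat.cast_succ, fourier_add, ih, pow_succ]

theorem norm_circleSeries_term (A : ℕ → ℂ) (n : ℕ) (t : AddCircle (2 * Real.pi)) :
    ‖A n * fourier 1 t ^ n‖ = ‖A n‖ := by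
  rw [norm_mul, norm_pow, norm_fourier_one_apply, one_pow, mul_one]

theorem summable_circleSeries {A : ℕ → ℂ} (hA : Summable fun n => ‖A n‖)
    (t : AddCircle (2 * Real.pi)) : Summable fun n => ‖A n * fourier 1 t ^ n‖ := by
  simpa only [norm_circleSeries_term] using hA

theorem continuous_circleSeries {A : ℕ → ℂ} (hA : Summable fun n => ‖A n‖) :
    Continuous (circleSeries A) := by
  refine continuous_tsum (fun n => ?_) hA fun n t => (norm_circleSeries_term A n t).le
  exact continuous_const.mul ((fourier 1).continuous.pow n)

/-- Only finitely many coefficients: the series is a polynomial. -/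
theorem circleSeries_eq_sum {A : ℕ → ℂ} {s : Finset ℕ} (hA : ∀ n ∉ s, A n = 0)
    (t : AddCircle (2 * Real.pi)) : circleSeries A t = ∑ n ∈ s, A n * fourier 1 t ^ n :=
  tsum_eq_sum fun n hn => by rw [hA n hn, zero_mul]

theorem integral_fourier_mul_fourier (n m : ℤ) :
    ∫ t : AddCircle (2 * Real.pi), (fourier (-n) t : ℂ) * fourier m t ∂haarAddCircle =
      if n = m then 1 else 0 := by
  have h := congrFun (fourierCoeff_fourier (T := 2 * Real.pi) m) n
  rw [Pi.single_apply] at h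
  simpa only [fourierCoeff, smul_eq_mul] using h

theorem hasSum_fourierCoeff_circleSeries {A : ℕ → ℂ} (hA : Summable fun n => ‖A n‖) (m : ℤ) :
    HasSum (fun n : ℕ => A n * if m = n then 1 else 0) (fourierCoeff (circleSeries A) m) := by
  have hc : ∀ n : ℕ, Continuous fun t : AddCircle (2 * Real.pi) =>
      (fourier (-m) t : ℂ) * (A n * fourier 1 t ^ n) := fun n =>
    (fourier (-m)).continuous.mul (continuous_const.mul ((fourier 1).continuous.pow n))
  have hn : ∀ (n : ℕ) (t : AddCircle (2 * Real.pi)),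
      ‖(fourier (-m) t : ℂ) * (A n * fourier 1 t ^ n)‖ = ‖A n‖ := fun n t => by
    rw [norm_mul, norm_circleSeries_term, fourier_apply, Circle.norm_coe, one_mul]
  have h := hasSum_integral_of_summable_integral_norm (μ := haarAddCircle)
    (F := fun (n : ℕ) (t : AddCircle (2 * Real.pi)) =>
      (fourier (-m) t : ℂ) * (A n * fourier 1 t ^ n))
    (fun n => (hc n).integrable_of_hasCompactSupport (HasCompactSupport.of_compactSpace _))
    (by simp only [hn]; simpa using hA)
  have h1 : ∀ n : ℕ, ∫ t : AddCircle (2 * Real.pi),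
      (fourier (-m) t : ℂ) * (A n * fourier 1 t ^ n) ∂haarAddCircle =
        A n * if m = n then 1 else 0 := fun n => by
    rw [← integral_fourier_mul_fourier, ← integral_const_mul]
    refine integral_congr_ae (Filter.Eventually.of_forall fun t => ?_)
    simp only [fourier_natCast_apply]
    ring
  have h2 : ∫ t : AddCircle (2 * Real.pi),
      ∑' n : ℕ, (fourier (-m) t : ℂ) * (A n * fourier 1 t ^ n) ∂haarAddCircle =
        fourierCoeff (circleSeries A) m :=
    integral_congr_ae (Filter.Eventually.of_forall fun t => by
      simp only [smul_eq_mul, circleSeries, tsum_mul_left])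
  rw [h2] at h
  simpa only [h1] using h

theorem fourierCoeff_circleSeries {A : ℕ → ℂ} (hA : Summable fun n => ‖A n‖) (m : ℕ) :
    fourierCoeff (circleSeries A) m = A m := by
  refine (hasSum_fourierCoeff_circleSeries hA m).unique ?_
  convert hasSum_ite_eq m (A m) using 2 with n
  by_cases h : n = m
  · simp [h]
  · rw [if_neg h, if_neg (by exact_mod_cast Ne.symm h), mul_zero]

theorem fourierCoeff_circleSeries_of_neg {A : ℕ → ℂ} (hA : Summable fun n => ‖A n‖) {m : ℤ}
    (hm : m < 0) : fourierCoeff (circleSeries A) m = 0 := by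
  refine (hasSum_fourierCoeff_circleSeries hA m).unique ?_
  convert hasSum_zero using 2 with n
  rw [if_neg (by lia), mul_zero]

/-- Parseval's identity for a power series on the circle. -/
theorem hasSum_norm_sq_circleSeries {A : ℕ → ℂ} (hA : Summable fun n => ‖A n‖) :
    HasSum (fun n => ‖A n‖ ^ 2) (∫ t, ‖circleSeries A t‖ ^ 2 ∂haarAddCircle) := by
  set F : C(AddCircle (2 * Real.pi), ℂ) := ⟨circleSeries A, continuous_circleSeries hA⟩
  have h := hasSum_sq_fourierCoeff (ContinuousMap.toLp (E := ℂ) 2 haarAddCircle ℂ F)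
  have hI : ∫ t, ‖ContinuousMap.toLp (E := ℂ) 2 haarAddCircle ℂ F t‖ ^ 2 ∂haarAddCircle =
      ∫ t, ‖circleSeries A t‖ ^ 2 ∂haarAddCircle := by
    refine integral_congr_ae ?_
    filter_upwards [ContinuousMap.coeFn_toLp (p := 2) (𝕜 := ℂ) haarAddCircle F] with t ht
    rw [ht]; rfl
  rw [hI] at h
  simp only [fourierCoeff_toLp] at h
  rw [← (Nat.cast_injective (R := ℤ)).hasSum_iff] at h
  · simpa only [Function.comp_def, F, ContinuousMap.coe_mk, fourierCoeff_circleSeries hA] using h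
  · intro m hm
    have hm' : m < 0 := by
      by_contra hcon
      exact hm ⟨m.toNat, by lia⟩
    simp only [F, ContinuousMap.coe_mk, fourierCoeff_circleSeries_of_neg hA hm', norm_zero]
    norm_num

/-- The boundary function of a product of power series has the Cauchy product coefficients. -/
theorem circleSeries_mul {A B : ℕ → ℂ} (hA : Summable fun n => ‖A n‖)
    (hB : Summable fun n => ‖B n‖) (t : AddCircle (2 * Real.pi)) :
    circleSeries A t * circleSeries B t =
      circleSeries (fun n => ∑ q ∈ Finset.HasAntidiagonal.antidiagonal n, A q.1 * B q.2) t := by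
  unfold circleSeries
  rw [tsum_mul_tsum_eq_tsum_sum_antidiagonal_of_summable_norm (summable_circleSeries hA t)
    (summable_circleSeries hB t)]
  refine tsum_congr fun n => ?_
  rw [Finset.sum_mul]
  refine Finset.sum_congr rfl fun q hq => ?_
  rw [← Finset.HasAntidiagonal.mem_antidiagonal.mp hq, pow_add]
  ring

theorem circleSeries_injective {A B : ℕ → ℂ} (hA : Summable fun n => ‖A n‖)
    (hB : Summable fun n => ‖B n‖) (h : circleSeries A = circleSeries B) : A = B := by
  ext n
  rw [← fourierCoeff_circleSeries hA, ← fourierCoeff_circleSeries hB, h]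

/-! ### The Hilbert inequality on finite sections -/

theorem norm_sq_lp_two (a : lp (fun _ : ℕ => ℂ) 2) : HasSum (fun n => ‖a n‖ ^ 2) (‖a‖ ^ 2) := by
  have h := lp.hasSum_norm (p := 2) (by norm_num) a
  simpa using h

theorem sqrt_sum_range_le_norm (a : lp (fun _ : ℕ => ℂ) 2) (N : ℕ) :
    Real.sqrt (∑ n ∈ Finset.range N, ‖a n‖ ^ 2) ≤ ‖a‖ := by
  refine Real.sqrt_le_iff.mpr ⟨norm_nonneg a, ?_⟩
  exact sum_le_hasSum _ (fun n _ => sq_nonneg _) (norm_sq_lp_two a)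

/-- The Hilbert inequality need only be checked on square sections of the double series. -/
theorem hilbertInequality_of_sections {c : ℕ → ℂ} {B : ℝ}
    (h : ∀ (a b : ℕ → ℂ) (N : ℕ),
      ∑ q ∈ Finset.range N ×ˢ Finset.range N, ‖a q.1‖ * ‖b q.2‖ * ‖c (q.1 + q.2)‖ ≤
        B * xNorm c * Real.sqrt (∑ n ∈ Finset.range N, ‖a n‖ ^ 2) *
          Real.sqrt (∑ n ∈ Finset.range N, ‖b n‖ ^ 2)) :
    HilbertInequality c B := by
  have h0 : 0 ≤ B * xNorm c := by
    have h1 := h (fun _ => 1) (fun _ => 1) 1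
    simp only [Finset.range_one, Finset.singleton_product_singleton, Finset.sum_singleton,
      norm_one, one_pow, Real.sqrt_one, mul_one, one_mul] at h1
    exact (norm_nonneg _).trans h1
  intro a b
  have hs : ∀ s : Finset (ℕ × ℕ), ∑ q ∈ s, ‖a q.1‖ * ‖b q.2‖ * ‖c (q.1 + q.2)‖ ≤
      B * xNorm c * ‖a‖ * ‖b‖ := by
    intro s
    obtain ⟨N, hN⟩ : ∃ N, s ⊆ Finset.range N ×ˢ Finset.range N := by
      refine ⟨s.sup (fun q => q.1 + q.2) + 1, fun q hq => ?_⟩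
      have := Finset.le_sup (f := fun q : ℕ × ℕ => q.1 + q.2) hq
      simp only [Finset.mem_product, Finset.mem_range]
      omega
    calc _ ≤ ∑ q ∈ Finset.range N ×ˢ Finset.range N, ‖a q.1‖ * ‖b q.2‖ * ‖c (q.1 + q.2)‖ :=
          Finset.sum_le_sum_of_subset_of_nonneg hN fun q _ _ => by positivity
      _ ≤ _ := h a b N
      _ ≤ B * xNorm c * ‖a‖ * ‖b‖ := by
          have ha := sqrt_sum_range_le_norm a N
          have hb := sqrt_sum_range_le_norm b N
          gcongr
  exact ⟨summable_of_sum_le (fun q => by positivity) hs,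
    Real.tsum_le_of_sum_le (fun q => by positivity) hs⟩

/-! ### A Schur test for sequences in the space `X` -/

/-- Summation by parts: if the averages of `d` are at most `K`, then replacing every `d k` by `K`
increases the sum against a nonnegative decreasing weight. -/
theorem sum_mul_le_of_antitone {d u : ℕ → ℝ} {K : ℝ}
    (hd : ∀ n : ℕ, ∑ k ∈ Finset.range n, d k ≤ K * n) (hu : Antitone u) (hu0 : ∀ n, 0 ≤ u n)
    (N : ℕ) : ∑ k ∈ Finset.range N, d k * u k ≤ K * ∑ k ∈ Finset.range N, u k := by
  have hE : ∀ n : ℕ, 0 ≤ ∑ k ∈ Finset.range n, (K - d k) := fun n => by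
    rw [Finset.sum_sub_distrib, Finset.sum_const, Finset.card_range, nsmul_eq_mul]
    linarith [hd n]
  have key : ∀ n : ℕ, (∑ k ∈ Finset.range n, (K - d k)) * u n ≤
      ∑ k ∈ Finset.range n, (K - d k) * u k := by
    intro n
    induction n with
    | zero => simp
    | succ n ih =>
      calc _ ≤ (∑ k ∈ Finset.range (n + 1), (K - d k)) * u n :=
            mul_le_mul_of_nonneg_left (hu n.le_succ) (hE _)
        _ ≤ _ := by
            rw [Finset.sum_range_succ, Finset.sum_range_succ, add_mul]
            linarith
  have h := (mul_nonneg (hE N) (hu0 N)).trans (key N)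
  simp only [sub_mul, Finset.sum_sub_distrib, ← Finset.mul_sum] at h
  linarith

theorem sum_inv_sqrt_le (N : ℕ) :
    ∑ k ∈ Finset.range N, (Real.sqrt (k + 1))⁻¹ ≤ 2 * Real.sqrt N := by
  induction N with
  | zero => simp
  | succ n ih =>
    rw [Finset.sum_range_succ]
    have hx : 0 ≤ Real.sqrt n := Real.sqrt_nonneg _
    have hy : 0 < Real.sqrt (n + 1 : ℝ) := Real.sqrt_pos.mpr (by positivity)
    have hx2 : Real.sqrt n ^ 2 = n := Real.sq_sqrt (by positivity)
    have hy2 : Real.sqrt (n + 1 : ℝ) ^ 2 = n + 1 := Real.sq_sqrt (by positivity)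
    push_cast
    set x := Real.sqrt n
    set y := Real.sqrt (n + 1 : ℝ)
    have : y⁻¹ ≤ 2 * (y - x) := by
      rw [inv_le_iff_one_le_mul₀ hy]
      nlinarith [sq_nonneg (y - x)]
    linarith

/-- The weight `(k + 1)^{-3/2}`, frozen for `k ≤ m` so that it is decreasing, has total mass of
the order of its tail beyond `m`. -/
theorem sum_inv_sqrt_max_pow_three_le (m N : ℕ) :
    ∑ k ∈ Finset.range N, (Real.sqrt ((max k m : ℕ) + 1) ^ 3)⁻¹ ≤ 3 * (Real.sqrt (m + 1))⁻¹ := by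
  have hpos : ∀ k : ℕ, 0 < Real.sqrt (k + 1 : ℝ) := fun k => Real.sqrt_pos.mpr (by positivity)
  have hsq : ∀ k : ℕ, Real.sqrt (k + 1 : ℝ) ^ 2 = k + 1 := fun k => Real.sq_sqrt (by positivity)
  have key : ∀ j : ℕ, ∑ k ∈ Finset.range (m + 1 + j), (Real.sqrt ((max k m : ℕ) + 1) ^ 3)⁻¹ ≤
      3 * (Real.sqrt (m + 1))⁻¹ - 2 * (Real.sqrt ((m + j : ℕ) + 1))⁻¹ := by
    intro j
    induction j with
    | zero =>
      have : ∀ k ∈ Finset.range (m + 1 + 0), (Real.sqrt ((max k m : ℕ) + 1 : ℝ) ^ 3)⁻¹ =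
          (Real.sqrt (m + 1 : ℝ) ^ 3)⁻¹ := fun k hk => by
        rw [max_eq_right (by have := Finset.mem_range.mp hk; omega)]
      rw [Finset.sum_congr rfl this, Finset.sum_const, Finset.card_range, nsmul_eq_mul]
      have h1 := hpos m
      have h2 := hsq m
      push_cast
      rw [add_zero, add_zero, ← h2]
      apply le_of_eq
      field_simp
      norm_num
    | succ j ih =>
      rw [← Nat.add_assoc, Finset.sum_range_succ, max_eq_left (by omega)]
      have hx := hpos (m + j)
      have hy := hpos (m + 1 + j)
      have hx2 := hsq (m + j)
      rw [show m + (j + 1) = m + 1 + j by omega]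
      have hcast : ((m + 1 + j : ℕ) : ℝ) = ((m + j : ℕ) : ℝ) + 1 := by push_cast; ring
      have hy2 : Real.sqrt ((m + 1 + j : ℕ) + 1 : ℝ) ^ 2 = ((m + j : ℕ) : ℝ) + 1 + 1 :=
        (hsq _).trans (by rw [hcast])
      have hxy : Real.sqrt ((m + j : ℕ) + 1 : ℝ) ≤ Real.sqrt ((m + 1 + j : ℕ) + 1 : ℝ) :=
        Real.sqrt_le_sqrt (by rw [hcast]; linarith)
      set x := Real.sqrt ((m + j : ℕ) + 1 : ℝ)
      set y := Real.sqrt ((m + 1 + j : ℕ) + 1 : ℝ)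
      have h1 : (y - x) * (y + x) = 1 := by nlinarith
      -- `1/x - 1/y = 1/(xy(x + y))` because `y² - x² = 1`
      have : (y ^ 3)⁻¹ ≤ 2 * (x⁻¹ - y⁻¹) := by
        have e : x⁻¹ - y⁻¹ = (x * y * (x + y))⁻¹ := by
          field_simp
          linarith
        rw [e, ← div_eq_mul_inv, inv_eq_one_div, div_le_div_iff₀ (by positivity) (by positivity)]
        nlinarith [mul_le_mul hxy hxy hx.le hy.le, mul_pos hx hy]
      linarith
  calc _ ≤ ∑ k ∈ Finset.range (m + 1 + N), (Real.sqrt ((max k m : ℕ) + 1) ^ 3)⁻¹ :=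
        Finset.sum_le_sum_of_subset_of_nonneg
          (Finset.range_subset_range.mpr (by omega)) fun k _ _ => by positivity
    _ ≤ _ := (key N).trans (sub_le_self _ (by positivity))

theorem xNorm_sq {c : ℕ → ℂ} : xNorm c ^ 2 = ⨆ n, xAverage c n :=
  Real.sq_sqrt (Real.iSup_nonneg fun n => by unfold xAverage; positivity)

theorem sum_le_xNorm_sq_mul {c : ℕ → ℂ} (hc : c ∈ SpaceX) (n : ℕ) :
    ∑ k ∈ Finset.range n, ((k : ℝ) + 1) ^ 2 * ‖c k‖ ^ 2 ≤ xNorm c ^ 2 * n := by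
  cases n with
  | zero => simp
  | succ n =>
    have h := le_ciSup (f := xAverage c) hc n
    rw [← xNorm_sq] at h
    unfold xAverage at h
    rw [div_le_iff₀ (by positivity)] at h
    exact_mod_cast h

/-- The column bound of the Schur test: on average `|c_k|²` is of size `k^{-2}`, and the sum of
`k^{-3/2}` beyond `m` is of size `m^{-1/2}`. -/
theorem sum_norm_sq_mul_sqrt_le {c : ℕ → ℂ} (hc : c ∈ SpaceX) (m N : ℕ) :
    ∑ n ∈ Finset.range N, ‖c (n + m)‖ ^ 2 * Real.sqrt (n + 1) ≤
      3 * xNorm c ^ 2 * (Real.sqrt (m + 1))⁻¹ := by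
  set d : ℕ → ℝ := fun k => ((k : ℝ) + 1) ^ 2 * ‖c k‖ ^ 2
  set u : ℕ → ℝ := fun k => (Real.sqrt ((max k m : ℕ) + 1) ^ 3)⁻¹
  have hu : Antitone u := fun i j hij => by
    have : ((max i m : ℕ) : ℝ) ≤ (max j m : ℕ) := by exact_mod_cast max_le_max_right m hij
    have h0 : 0 < Real.sqrt ((max i m : ℕ) + 1) := Real.sqrt_pos.mpr (by positivity)
    dsimp only [u]
    gcongr
  calc _ ≤ ∑ n ∈ Finset.range N, d (n + m) * u (n + m) := by
        refine Finset.sum_le_sum fun n _ => ?_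
        dsimp only [d, u]
        rw [max_eq_left (Nat.le_add_left m n)]
        have hy : 0 < Real.sqrt ((n + m : ℕ) + 1) := Real.sqrt_pos.mpr (by positivity)
        have hy2 : Real.sqrt ((n + m : ℕ) + 1) ^ 2 = (n + m : ℕ) + 1 :=
          Real.sq_sqrt (by positivity)
        have hle : Real.sqrt (n + 1) ≤ Real.sqrt ((n + m : ℕ) + 1) :=
          Real.sqrt_le_sqrt (by push_cast; linarith [m.cast_nonneg (α := ℝ)])
        set y := Real.sqrt ((n + m : ℕ) + 1)
        rw [← hy2]
        have e : (y ^ 2) ^ 2 * ‖c (n + m)‖ ^ 2 * (y ^ 3)⁻¹ = ‖c (n + m)‖ ^ 2 * y := by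
          field_simp
        rw [e]
        gcongr
    _ ≤ ∑ k ∈ Finset.range (m + N), d k * u k := by
        rw [Finset.sum_range_add, Finset.sum_congr rfl fun n _ => by rw [Nat.add_comm n m]]
        refine le_add_of_nonneg_left (Finset.sum_nonneg fun k _ => ?_)
        positivity
    _ ≤ xNorm c ^ 2 * ∑ k ∈ Finset.range (m + N), u k :=
        sum_mul_le_of_antitone (sum_le_xNorm_sq_mul hc) hu (fun n => by positivity) _
    _ ≤ xNorm c ^ 2 * (3 * (Real.sqrt (m + 1))⁻¹) := by
        have := sum_inv_sqrt_max_pow_three_le m (m + N)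
        gcongr
    _ = _ := by ring

/-- Half of the Hilbert inequality for `c ∈ X`: the part of the double sum below the diagonal.
The Cauchy-Schwarz inequality is used with the weight `((n + 1) (m + 1))^{-1/2}`. -/
theorem sum_below_diagonal_le {c : ℕ → ℂ} (hc : c ∈ SpaceX) (a b : ℕ → ℂ) (N : ℕ) :
    ∑ n ∈ Finset.range N, ∑ m ∈ Finset.range N,
      (if m ≤ n then ‖a n‖ * ‖b m‖ * ‖c (n + m)‖ else 0) ≤
      Real.sqrt 6 * xNorm c * Real.sqrt (∑ n ∈ Finset.range N, ‖a n‖ ^ 2) *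
        Real.sqrt (∑ n ∈ Finset.range N, ‖b n‖ ^ 2) := by
  have hpos : ∀ k : ℕ, 0 < Real.sqrt (k + 1 : ℝ) := fun k => Real.sqrt_pos.mpr (by positivity)
  set f : ℕ × ℕ → ℝ := fun q =>
    if q.2 ≤ q.1 then ‖a q.1‖ ^ 2 * (Real.sqrt (q.1 + 1))⁻¹ * (Real.sqrt (q.2 + 1))⁻¹ else 0
  set g : ℕ × ℕ → ℝ := fun q =>
    ‖b q.2‖ ^ 2 * Real.sqrt (q.2 + 1) * (‖c (q.1 + q.2)‖ ^ 2 * Real.sqrt (q.1 + 1))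
  have hCS := Finset.sum_sq_le_sum_mul_sum_of_sq_le_mul (Finset.range N ×ˢ Finset.range N)
    (r := fun q => if q.2 ≤ q.1 then ‖a q.1‖ * ‖b q.2‖ * ‖c (q.1 + q.2)‖ else 0) (f := f) (g := g)
    (fun q _ => by dsimp only [f]; split_ifs <;> positivity) (fun q _ => by positivity)
    (fun q _ => by
      have h1 := hpos q.1
      have h2 := hpos q.2
      dsimp only [f, g]
      split_ifs
      · exact le_of_eq (by field_simp)
      · simp)
  have hf : ∑ q ∈ Finset.range N ×ˢ Finset.range N, f q ≤
      2 * ∑ n ∈ Finset.range N, ‖a n‖ ^ 2 := by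
    rw [Finset.sum_product, Finset.mul_sum]
    refine Finset.sum_le_sum fun n hn => ?_
    have hsub : (Finset.range N).filter (· ≤ n) = Finset.range (n + 1) := by
      ext m
      simp only [Finset.mem_filter, Finset.mem_range] at hn ⊢
      omega
    dsimp only [f]
    rw [← Finset.sum_filter, hsub, ← Finset.mul_sum]
    have h := sum_inv_sqrt_le (n + 1)
    push_cast at h
    have hn0 := hpos n
    calc _ ≤ ‖a n‖ ^ 2 * (Real.sqrt (n + 1))⁻¹ * (2 * Real.sqrt (n + 1)) := by gcongr
      _ = _ := by field_simp
  have hg : ∑ q ∈ Finset.range N ×ˢ Finset.range N, g q ≤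
      3 * xNorm c ^ 2 * ∑ n ∈ Finset.range N, ‖b n‖ ^ 2 := by
    rw [Finset.sum_product_right, Finset.mul_sum]
    refine Finset.sum_le_sum fun m _ => ?_
    dsimp only [g]
    rw [← Finset.mul_sum]
    have hm0 := hpos m
    calc _ ≤ ‖b m‖ ^ 2 * Real.sqrt (m + 1) * (3 * xNorm c ^ 2 * (Real.sqrt (m + 1))⁻¹) := by
          have := sum_norm_sq_mul_sqrt_le hc m N
          gcongr
      _ = _ := by field_simp
  rw [Finset.sum_product] at hCS
  have hx : 0 ≤ xNorm c := Real.sqrt_nonneg _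
  refine le_of_sq_le_sq (hCS.trans ?_) (by positivity)
  calc _ ≤ (2 * ∑ n ∈ Finset.range N, ‖a n‖ ^ 2) *
        (3 * xNorm c ^ 2 * ∑ n ∈ Finset.range N, ‖b n‖ ^ 2) :=
        mul_le_mul hf hg (Finset.sum_nonneg fun q _ => by positivity) (by positivity)
    _ = _ := by
        rw [mul_pow, mul_pow, mul_pow, Real.sq_sqrt (by positivity), Real.sq_sqrt (by positivity),
          Real.sq_sqrt (by positivity)]
        ring

theorem hilbertInequality_of_mem_spaceX {c : ℕ → ℂ} (hc : c ∈ SpaceX) :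
    HilbertInequality c (2 * Real.sqrt 6) := by
  refine hilbertInequality_of_sections fun a b N => ?_
  have h1 := sum_below_diagonal_le hc a b N
  have h2 := sum_below_diagonal_le hc b a N
  rw [Finset.sum_comm] at h2
  calc _ ≤ (∑ n ∈ Finset.range N, ∑ m ∈ Finset.range N,
          if m ≤ n then ‖a n‖ * ‖b m‖ * ‖c (n + m)‖ else 0) +
        ∑ n ∈ Finset.range N, ∑ m ∈ Finset.range N,
          if n ≤ m then ‖b m‖ * ‖a n‖ * ‖c (m + n)‖ else 0 := by
        rw [Finset.sum_product, ← Finset.sum_add_distrib]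
        refine Finset.sum_le_sum fun n _ => ?_
        rw [← Finset.sum_add_distrib]
        refine Finset.sum_le_sum fun m _ => ?_
        rw [mul_comm ‖b m‖, Nat.add_comm m n]
        have : 0 ≤ ‖a n‖ * ‖b m‖ * ‖c (n + m)‖ := by positivity
        split_ifs <;> linarith
    _ ≤ _ := add_le_add h1 h2
    _ = _ := by ring

/-! ### From the Hardy inequality to the Hilbert inequality -/

/-- An absolutely convergent power series is an element of `H^1`. -/
theorem exists_mem_hardySpace_coeff_eq {A : ℕ → ℂ} (hA : Summable fun n => ‖A n‖) :
    ∃ f ∈ HardySpace 1, (∀ n : ℕ, coeff f n = A n) ∧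
      ‖f‖ = ∫ t, ‖circleSeries A t‖ ∂haarAddCircle := by
  set F : C(AddCircle (2 * Real.pi), ℂ) := ⟨circleSeries A, continuous_circleSeries hA⟩
  have hF := ContinuousMap.coeFn_toLp (p := 1) (𝕜 := ℂ) haarAddCircle F
  have hcoeff : ∀ m : ℤ, coeff (ContinuousMap.toLp (E := ℂ) 1 haarAddCircle ℂ F) m =
      fourierCoeff (circleSeries A) m := fun m => congrFun (fourierCoeff_congr_ae hF) m
  refine ⟨ContinuousMap.toLp (E := ℂ) 1 haarAddCircle ℂ F, fun m hm => ?_, fun n => ?_, ?_⟩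
  · rw [hcoeff, fourierCoeff_circleSeries_of_neg hA hm]
  · rw [hcoeff, fourierCoeff_circleSeries hA]
  · rw [L1.norm_eq_integral_norm]
    refine integral_congr_ae ?_
    filter_upwards [hF] with t ht
    rw [ht]; rfl

/-- The Cauchy-Schwarz inequality on the circle. -/
theorem integral_norm_mul_le {F G : AddCircle (2 * Real.pi) → ℂ} (hF : Continuous F)
    (hG : Continuous G) :
    ∫ t, ‖F t * G t‖ ∂haarAddCircle ≤
      Real.sqrt (∫ t, ‖F t‖ ^ 2 ∂haarAddCircle) * Real.sqrt (∫ t, ‖G t‖ ^ 2 ∂haarAddCircle) := by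
  have hm : ∀ {H : AddCircle (2 * Real.pi) → ℂ}, Continuous H →
      MemLp (fun t => ‖H t‖) (ENNReal.ofReal 2) haarAddCircle := fun hH =>
    hH.norm.memLp_of_hasCompactSupport (HasCompactSupport.of_compactSpace _)
  have h := integral_mul_le_Lp_mul_Lq_of_nonneg Real.HolderConjugate.two_two
    (Filter.Eventually.of_forall fun t => norm_nonneg (F t))
    (Filter.Eventually.of_forall fun t => norm_nonneg (G t)) (hm hF) (hm hG)
  simpa only [norm_mul, Real.rpow_two, ← Real.sqrt_eq_rpow] using h

theorem norm_circleSeries_single (t : AddCircle (2 * Real.pi)) :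
    ‖circleSeries (Pi.single 0 1) t‖ = 1 := by
  rw [circleSeries_eq_sum (s := {0}) (fun n hn => by
    rw [Pi.single_eq_of_ne (by simpa using hn)])]
  simp

/-- The inequality for the constant function `1`. -/
theorem HardyInequality.mul_xNorm_nonneg {c : ℕ → ℂ} {C : ℝ} (h : HardyInequality c C) :
    0 ≤ C * xNorm c := by
  have hA : Summable fun n => ‖(Pi.single 0 1 : ℕ → ℂ) n‖ :=
    summable_of_ne_finset_zero (s := {0}) fun n hn => by
      rw [Pi.single_eq_of_ne (by simpa using hn), norm_zero]
  obtain ⟨f, hf, -, hnorm⟩ := exists_mem_hardySpace_coeff_eq hA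
  have h1 := (h f hf).2
  rw [hnorm] at h1
  simp only [norm_circleSeries_single, integral_const, probReal_univ, smul_eq_mul, mul_one] at h1
  exact (tsum_nonneg fun n => norm_nonneg _).trans h1

/-- The moduli `|a_0|, …, |a_{N-1}|`, followed by zeros. -/
noncomputable def normSection (a : ℕ → ℂ) (N n : ℕ) : ℝ :=
  if n < N then ‖a n‖ else 0

theorem normSection_of_lt (a : ℕ → ℂ) {N n : ℕ} (h : n < N) : normSection a N n = ‖a n‖ :=
  if_pos h

theorem normSection_of_notMem (a : ℕ → ℂ) {N n : ℕ} (h : n ∉ Finset.range N) :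
    normSection a N n = 0 :=
  if_neg (mt Finset.mem_range.mpr h)

theorem normSection_nonneg (a : ℕ → ℂ) (N n : ℕ) : 0 ≤ normSection a N n := by
  unfold normSection
  split_ifs <;> positivity

theorem summable_normSection (a : ℕ → ℂ) (N : ℕ) :
    Summable fun n => ‖(normSection a N n : ℂ)‖ :=
  summable_of_ne_finset_zero (s := Finset.range N) fun n hn => by
    rw [normSection_of_notMem a hn, Complex.ofReal_zero, norm_zero]

theorem integral_norm_sq_normSection (a : ℕ → ℂ) (N : ℕ) :
    ∫ t, ‖circleSeries (fun n => (normSection a N n : ℂ)) t‖ ^ 2 ∂haarAddCircle =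
      ∑ n ∈ Finset.range N, ‖a n‖ ^ 2 := by
  rw [← (hasSum_norm_sq_circleSeries (summable_normSection a N)).tsum_eq,
    tsum_eq_sum (s := Finset.range N) fun n hn => by rw [normSection_of_notMem a hn]; norm_num]
  refine Finset.sum_congr rfl fun n hn => ?_
  rw [normSection_of_lt a (Finset.mem_range.mp hn), Complex.norm_real, norm_norm]

/-- A square section of the Hilbert sum, regrouped along antidiagonals. -/
theorem sum_section_le (a b c : ℕ → ℂ) (N : ℕ) :
    ∑ q ∈ Finset.range N ×ˢ Finset.range N, ‖a q.1‖ * ‖b q.2‖ * ‖c (q.1 + q.2)‖ ≤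
      ∑ n ∈ Finset.range (2 * N), ‖(∑ q ∈ Finset.HasAntidiagonal.antidiagonal n,
        (normSection a N q.1 : ℂ) * normSection b N q.2) * c n‖ := by
  have hmaps : ∀ q ∈ Finset.range N ×ˢ Finset.range N, q.1 + q.2 ∈ Finset.range (2 * N) :=
    fun q hq => by
      simp only [Finset.mem_product, Finset.mem_range] at hq ⊢
      omega
  rw [← Finset.sum_fiberwise_of_maps_to hmaps]
  refine Finset.sum_le_sum fun n _ => ?_
  have hn : ‖∑ q ∈ Finset.HasAntidiagonal.antidiagonal n,
      (normSection a N q.1 : ℂ) * normSection b N q.2‖ =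
        ∑ q ∈ Finset.HasAntidiagonal.antidiagonal n, normSection a N q.1 * normSection b N q.2 := by
    simp only [← Complex.ofReal_mul, ← Complex.ofReal_sum]
    rw [Complex.norm_real, Real.norm_of_nonneg (Finset.sum_nonneg fun q _ =>
      mul_nonneg (normSection_nonneg _ _ _) (normSection_nonneg _ _ _))]
  rw [norm_mul, hn, Finset.sum_mul]
  calc _ = ∑ q ∈ Finset.range N ×ˢ Finset.range N with q.1 + q.2 = n,
        normSection a N q.1 * normSection b N q.2 * ‖c n‖ := by
        refine Finset.sum_congr rfl fun q hq => ?_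
        simp only [Finset.mem_filter, Finset.mem_product, Finset.mem_range] at hq
        rw [normSection_of_lt a hq.1.1, normSection_of_lt b hq.1.2, hq.2]
    _ ≤ _ := by
        refine Finset.sum_le_sum_of_subset_of_nonneg (fun q hq => ?_) fun q _ _ =>
          mul_nonneg (mul_nonneg (normSection_nonneg _ _ _) (normSection_nonneg _ _ _))
            (norm_nonneg _)
        exact Finset.HasAntidiagonal.mem_antidiagonal.mpr (Finset.mem_filter.mp hq).2

/-- Sections of `ℓ²` sequences with the moduli of the coefficients are polynomials `g` and `h`;
the Hardy inequality is applied to `gh`, whose coefficients sum the moduli over antidiagonals. -/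
theorem HardyInequality.hilbertInequality {c : ℕ → ℂ} {C : ℝ} (h : HardyInequality c C) :
    HilbertInequality c C := by
  refine hilbertInequality_of_sections fun a b N => ?_
  have hA := summable_normSection a N
  have hB := summable_normSection b N
  obtain ⟨f, hf, hcoeff, hnorm⟩ := exists_mem_hardySpace_coeff_eq
    (summable_norm_sum_mul_antidiagonal_of_summable_norm hA hB)
  have hfle : ‖f‖ ≤ Real.sqrt (∑ n ∈ Finset.range N, ‖a n‖ ^ 2) *
      Real.sqrt (∑ n ∈ Finset.range N, ‖b n‖ ^ 2) := by
    rw [hnorm, ← integral_norm_sq_normSection a, ← integral_norm_sq_normSection b]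
    simp only [← circleSeries_mul hA hB]
    exact integral_norm_mul_le (continuous_circleSeries hA) (continuous_circleSeries hB)
  obtain ⟨hsum, hle⟩ := h f hf
  simp only [hcoeff] at hsum hle
  calc _ ≤ _ := sum_section_le a b c N
    _ ≤ _ := hsum.sum_le_tsum _ fun n _ => norm_nonneg _
    _ ≤ C * xNorm c * ‖f‖ := hle
    _ ≤ _ := by
        rw [mul_assoc (C * xNorm c)]
        exact mul_le_mul_of_nonneg_left hfle h.mul_xNorm_nonneg

/-! ### Riesz factorization of polynomials -/

/-- A Riesz factorization of the polynomial `p` in the open unit disc: `p = B F`, where `B` is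
bounded by `1` (a Blaschke product), `F` is a polynomial with `|F| = |p|` on the unit circle, and
`F = G²` has a holomorphic square root in the disc. -/
def HasRieszFactorization (p : Polynomial ℂ) : Prop :=
  ∃ (F : Polynomial ℂ) (B G : ℂ → ℂ), DifferentiableOn ℂ B (Metric.ball 0 1) ∧
    DifferentiableOn ℂ G (Metric.ball 0 1) ∧ (∀ z ∈ Metric.ball (0 : ℂ) 1, ‖B z‖ ≤ 1) ∧
    (∀ z ∈ Metric.ball (0 : ℂ) 1, F.eval z = G z ^ 2) ∧
    (∀ z ∈ Metric.ball (0 : ℂ) 1, p.eval z = B z * F.eval z) ∧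
    ∀ z : ℂ, ‖z‖ = 1 → ‖F.eval z‖ = ‖p.eval z‖

theorem HasRieszFactorization.mul {p q : Polynomial ℂ} (hp : HasRieszFactorization p)
    (hq : HasRieszFactorization q) : HasRieszFactorization (p * q) := by
  obtain ⟨F, B, G, hB, hG, hB1, hFG, hpF, hn⟩ := hp
  obtain ⟨F', B', G', hB', hG', hB1', hFG', hpF', hn'⟩ := hq
  refine ⟨F * F', fun z => B z * B' z, fun z => G z * G' z, hB.mul hB', hG.mul hG',
    fun z hz => ?_, fun z hz => ?_, fun z hz => ?_, fun z hz => ?_⟩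
  · rw [norm_mul]
    exact mul_le_one₀ (hB1 z hz) (norm_nonneg _) (hB1' z hz)
  · rw [Polynomial.eval_mul, hFG z hz, hFG' z hz, mul_pow]
  · rw [Polynomial.eval_mul, Polynomial.eval_mul, hpF z hz, hpF' z hz]
    ring
  · rw [Polynomial.eval_mul, Polynomial.eval_mul, norm_mul, norm_mul, hn z hz, hn' z hz]

theorem hasRieszFactorization_C (a : ℂ) : HasRieszFactorization (Polynomial.C a) := by
  refine ⟨Polynomial.C a, fun _ => 1, fun _ => a ^ (1 / 2 : ℂ), by fun_prop, by fun_prop, ?_, ?_,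
    ?_, ?_⟩ <;> intro z _
  · simp
  · rw [Polynomial.eval_C, ← Complex.cpow_nat_mul]
    norm_num
  · simp
  · rfl

theorem one_sub_mul_mem_slitPlane {u z : ℂ} (hu : ‖u‖ ≤ 1) (hz : z ∈ Metric.ball (0 : ℂ) 1) :
    1 - u * z ∈ Complex.slitPlane := by
  left
  have h1 : ‖u * z‖ < 1 := by
    rw [norm_mul]
    rw [mem_ball_zero_iff] at hz
    exact (mul_le_of_le_one_left (norm_nonneg z) hu).trans_lt hz
  have h2 := (Complex.re_le_norm (u * z)).trans_lt h1
  rw [Complex.sub_re, Complex.one_re]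
  linarith

theorem differentiableOn_sqrt_one_sub_mul {u : ℂ} (hu : ‖u‖ ≤ 1) :
    DifferentiableOn ℂ (fun z => (1 - u * z) ^ (1 / 2 : ℂ)) (Metric.ball 0 1) := fun _ hz =>
  (((differentiableAt_const _).sub (differentiableAt_id.const_mul u)).cpow
    (differentiableAt_const _) (one_sub_mul_mem_slitPlane hu hz)).differentiableWithinAt

theorem norm_one_sub_conj_mul_sq (w z : ℂ) :
    ‖1 - (starRingEnd ℂ) w * z‖ ^ 2 =
      ‖z - w‖ ^ 2 + (1 - ‖z‖ ^ 2) * (1 - ‖w‖ ^ 2) := by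
  simp only [← Complex.normSq_eq_norm_sq, Complex.normSq_apply, Complex.sub_re, Complex.sub_im,
    Complex.mul_re, Complex.mul_im, Complex.conj_re, Complex.conj_im, Complex.one_re,
    Complex.one_im]
  ring

/-- A zero inside the disc is moved to the Blaschke factor `(z - w) / (1 - w̄ z)`; a zero outside
the open disc stays in the zero-free part. -/
theorem hasRieszFactorization_X_sub_C (w : ℂ) :
    HasRieszFactorization (Polynomial.X - Polynomial.C w) := by
  by_cases hw : ‖w‖ < 1
  · set u := (starRingEnd ℂ) w
    have hu : ‖u‖ ≤ 1 := by rw [RCLike.norm_conj]; exact hw.le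
    have hne : ∀ z ∈ Metric.ball (0 : ℂ) 1, 1 - u * z ≠ 0 := fun z hz =>
      Complex.slitPlane_ne_zero (one_sub_mul_mem_slitPlane hu hz)
    refine ⟨1 - Polynomial.C u * Polynomial.X, fun z => (z - w) / (1 - u * z),
      fun z => (1 - u * z) ^ (1 / 2 : ℂ), ?_, differentiableOn_sqrt_one_sub_mul hu, fun z hz => ?_,
      fun z _ => ?_, fun z hz => ?_, fun z hz => ?_⟩
    · exact DifferentiableOn.div (by fun_prop) (by fun_prop) hne
    · rw [norm_div]
      refine div_le_one_of_le₀ ?_ (norm_nonneg _)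
      rw [mem_ball_zero_iff] at hz
      refine le_of_sq_le_sq ?_ (norm_nonneg _)
      rw [norm_one_sub_conj_mul_sq]
      have h1 : 0 ≤ 1 - ‖z‖ ^ 2 := by nlinarith [norm_nonneg z]
      have h2 : 0 ≤ 1 - ‖w‖ ^ 2 := by nlinarith [norm_nonneg w]
      nlinarith [mul_nonneg h1 h2]
    · rw [← Complex.cpow_nat_mul]
      norm_num
    · have := hne z hz
      simp only [Polynomial.eval_sub, Polynomial.eval_X, Polynomial.eval_C, Polynomial.eval_one,
        Polynomial.eval_mul]
      rw [div_mul_cancel₀ _ this]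
    · simp only [Polynomial.eval_sub, Polynomial.eval_X, Polynomial.eval_C, Polynomial.eval_one,
        Polynomial.eval_mul]
      rw [← sq_eq_sq₀ (norm_nonneg _) (norm_nonneg _), norm_one_sub_conj_mul_sq, hz]
      ring
  · have hw1 : 1 ≤ ‖w‖ := not_lt.mp hw
    have hw0 : w ≠ 0 := fun h => by rw [h, norm_zero] at hw1; linarith
    have hu : ‖w⁻¹‖ ≤ 1 := by rw [norm_inv]; exact inv_le_one_of_one_le₀ hw1
    refine ⟨Polynomial.X - Polynomial.C w, fun _ => 1,
      fun z => (-w) ^ (1 / 2 : ℂ) * (1 - w⁻¹ * z) ^ (1 / 2 : ℂ), by fun_prop,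
      (differentiableOn_sqrt_one_sub_mul hu).const_mul _, fun z _ => by simp, fun z _ => ?_,
      fun z _ => by rw [one_mul], fun z _ => rfl⟩
    rw [mul_pow, ← Complex.cpow_nat_mul, ← Complex.cpow_nat_mul]
    norm_num
    field_simp
    ring

theorem hasRieszFactorization (p : Polynomial ℂ) : HasRieszFactorization p := by
  rw [(IsAlgClosed.splits p).eq_prod_roots]
  refine (hasRieszFactorization_C _).mul ?_
  induction p.roots using Multiset.induction with
  | empty => simpa using hasRieszFactorization_C 1
  | cons w s ih =>
    rw [Multiset.map_cons, Multiset.prod_cons]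
    exact (hasRieszFactorization_X_sub_C w).mul ih

/-! ### From the Hilbert inequality to the Hardy inequality for polynomials -/

/-- The dilates `z ↦ g(rz)`, `r < 1`, of a function holomorphic in the disc are absolutely
convergent power series on the circle. -/
theorem exists_circleSeries_eq_dilate {g : ℂ → ℂ} (hg : DifferentiableOn ℂ g (Metric.ball 0 1))
    {r : ℝ} (hr0 : 0 ≤ r) (hr1 : r < 1) :
    ∃ A : ℕ → ℂ, (Summable fun n => ‖A n‖) ∧ ∀ t, circleSeries A t = g (r * fourier 1 t) := by
  set A : ℕ → ℂ := fun n => (n.factorial : ℂ)⁻¹ * iteratedDeriv n g 0 * (r : ℂ) ^ n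
  have hmem : ∀ w : ℂ, ‖w‖ = 1 → (r * w : ℂ) ∈ Metric.ball (0 : ℂ) 1 := fun w hw => by
    rw [mem_ball_zero_iff, norm_mul, Complex.norm_real, Real.norm_of_nonneg hr0, hw, mul_one]
    exact hr1
  have h : ∀ w : ℂ, ‖w‖ = 1 → HasSum (fun n => A n * w ^ n) (g (r * w)) := fun w hw => by
    refine (Complex.hasSum_taylorSeries_on_ball hg (hmem w hw)).congr_fun fun n => ?_
    simp only [A, sub_zero, smul_eq_mul, mul_pow]
    ring
  refine ⟨A, ?_, fun t => (h _ (norm_fourier_one_apply t)).tsum_eq⟩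
  have := (h 1 norm_one).summable.norm
  simpa only [one_pow, mul_one] using this

theorem memℓp_two_of_summable_norm {A : ℕ → ℂ} (hA : Summable fun n => ‖A n‖) : Memℓp A 2 :=
  memℓp_gen (by simpa using (hasSum_norm_sq_circleSeries hA).summable)

theorem norm_lp_two_eq_sqrt_integral {A : ℕ → ℂ} (hA : Summable fun n => ‖A n‖) :
    ‖(⟨A, memℓp_two_of_summable_norm hA⟩ : lp (fun _ : ℕ => ℂ) 2)‖ =
      Real.sqrt (∫ t, ‖circleSeries A t‖ ^ 2 ∂haarAddCircle) := by
  rw [(hasSum_norm_sq_circleSeries hA).unique (norm_sq_lp_two ⟨A, memℓp_two_of_summable_norm hA⟩),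
    Real.sqrt_sq (norm_nonneg _)]

/-- The inequality for `a = b = (1, 0, 0, …)`. The constant `C` itself may be negative if
`xNorm c = 0`. -/
theorem HilbertInequality.mul_xNorm_nonneg {c : ℕ → ℂ} {C : ℝ} (h : HilbertInequality c C) :
    0 ≤ C * xNorm c := by
  set e : lp (fun _ : ℕ => ℂ) 2 := lp.single 2 0 1
  have he : ‖e‖ = 1 := by rw [lp.norm_single (by norm_num), norm_one]
  have h1 := (h e e).2
  rw [he, mul_one, mul_one] at h1
  exact (tsum_nonneg fun q => by positivity).trans h1

/-- The Hilbert inequality controls the coefficients of a product of two power series. -/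
theorem HilbertInequality.sum_norm_cauchyProduct_mul_le {c : ℕ → ℂ} {C : ℝ}
    (h : HilbertInequality c C) (a b : lp (fun _ : ℕ => ℂ) 2) (M : ℕ) :
    ∑ n ∈ Finset.range M, ‖(∑ q ∈ Finset.HasAntidiagonal.antidiagonal n, a q.1 * b q.2) * c n‖ ≤
      C * xNorm c * ‖a‖ * ‖b‖ := by
  set s := (Finset.range M ×ˢ Finset.range M).filter fun q => q.1 + q.2 < M
  calc _ ≤ ∑ n ∈ Finset.range M, ∑ q ∈ s with q.1 + q.2 = n,
        ‖a q.1‖ * ‖b q.2‖ * ‖c (q.1 + q.2)‖ := by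
        refine Finset.sum_le_sum fun n hn => ?_
        rw [Finset.mem_range] at hn
        have hs : s.filter (fun q => q.1 + q.2 = n) =
            Finset.HasAntidiagonal.antidiagonal n := by
          ext q
          simp only [s, Finset.mem_filter, Finset.mem_product, Finset.mem_range,
            Finset.HasAntidiagonal.mem_antidiagonal]
          omega
        rw [hs, norm_mul]
        calc _ ≤ (∑ q ∈ Finset.HasAntidiagonal.antidiagonal n, ‖a q.1 * b q.2‖) * ‖c n‖ := by
              gcongr
              exact norm_sum_le _ _
          _ = _ := by
              rw [Finset.sum_mul]
              refine Finset.sum_congr rfl fun q hq => ?_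
              rw [norm_mul, Finset.HasAntidiagonal.mem_antidiagonal.mp hq]
    _ = ∑ q ∈ s, ‖a q.1‖ * ‖b q.2‖ * ‖c (q.1 + q.2)‖ :=
        Finset.sum_fiberwise_of_maps_to
          (fun q hq => Finset.mem_range.mpr (Finset.mem_filter.mp hq).2) _
    _ ≤ _ := (h a b).1.sum_le_tsum _ fun q _ => by positivity
    _ ≤ _ := (h a b).2

theorem summable_norm_polynomial_coeff (p : Polynomial ℂ) (r : ℂ) :
    Summable fun n => ‖p.coeff n * r ^ n‖ :=
  summable_of_ne_finset_zero (s := p.support) fun n hn => by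
    rw [Polynomial.notMem_support_iff.mp hn, zero_mul, norm_zero]

theorem circleSeries_polynomial_coeff (p : Polynomial ℂ) (r : ℂ) (t : AddCircle (2 * Real.pi)) :
    circleSeries (fun n => p.coeff n * r ^ n) t = p.eval (r * fourier 1 t) := by
  rw [circleSeries_eq_sum (s := p.support) fun n hn => by
    rw [Polynomial.notMem_support_iff.mp hn, zero_mul], Polynomial.eval_eq_sum, Polynomial.sum]
  exact Finset.sum_congr rfl fun n _ => by rw [mul_pow, mul_assoc]

/-- The Riesz factors `BG` and `G` of `p`, restricted to the circle of radius `r < 1`, have square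
integral at most that of `|F|`, and the Hilbert inequality is applied to their coefficients. -/
theorem HilbertInequality.sum_dilate_le {c : ℕ → ℂ} {C : ℝ} (h : HilbertInequality c C)
    {p F : Polynomial ℂ} {B G : ℂ → ℂ} (hB : DifferentiableOn ℂ B (Metric.ball 0 1))
    (hG : DifferentiableOn ℂ G (Metric.ball 0 1)) (hB1 : ∀ z ∈ Metric.ball (0 : ℂ) 1, ‖B z‖ ≤ 1)
    (hFG : ∀ z ∈ Metric.ball (0 : ℂ) 1, F.eval z = G z ^ 2)
    (hpF : ∀ z ∈ Metric.ball (0 : ℂ) 1, p.eval z = B z * F.eval z)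
    {r : ℝ} (hr0 : 0 ≤ r) (hr1 : r < 1) (M : ℕ) :
    ∑ n ∈ Finset.range M, ‖p.coeff n * (r : ℂ) ^ n * c n‖ ≤
      C * xNorm c * ∫ t : AddCircle (2 * Real.pi), ‖F.eval ((r : ℂ) * fourier 1 t)‖ ∂haarAddCircle := by
  obtain ⟨U, hU, hUeq⟩ := exists_circleSeries_eq_dilate (hB.mul hG) hr0 hr1
  obtain ⟨V, hV, hVeq⟩ := exists_circleSeries_eq_dilate hG hr0 hr1
  have hmem : ∀ t : AddCircle (2 * Real.pi), (r * fourier 1 t : ℂ) ∈ Metric.ball (0 : ℂ) 1 :=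
    fun t => by
      rw [mem_ball_zero_iff, norm_mul, Complex.norm_real, Real.norm_of_nonneg hr0,
        norm_fourier_one_apply, mul_one]
      exact hr1
  have hcoeff : (fun n => p.coeff n * (r : ℂ) ^ n) =
      fun n => ∑ q ∈ Finset.HasAntidiagonal.antidiagonal n, U q.1 * V q.2 := by
    refine circleSeries_injective (summable_norm_polynomial_coeff p r)
      (summable_norm_sum_mul_antidiagonal_of_summable_norm hU hV) (funext fun t => ?_)
    rw [← circleSeries_mul hU hV, hUeq, hVeq, circleSeries_polynomial_coeff, hpF _ (hmem t),
      hFG _ (hmem t), Pi.mul_apply]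
    ring
  have hint : ∀ {W : ℕ → ℂ}, (Summable fun n => ‖W n‖) →
      Integrable (fun t => ‖circleSeries W t‖ ^ 2) haarAddCircle := fun hW =>
    ((continuous_circleSeries hW).norm.pow 2).integrable_of_hasCompactSupport
      (HasCompactSupport.of_compactSpace _)
  have hVint : ∫ t, ‖circleSeries V t‖ ^ 2 ∂haarAddCircle =
      ∫ t : AddCircle (2 * Real.pi), ‖F.eval ((r : ℂ) * fourier 1 t)‖ ∂haarAddCircle :=
    integral_congr_ae (Filter.Eventually.of_forall fun t => by
      simp only [hVeq, hFG _ (hmem t), norm_pow])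
  have hUint : ∫ t, ‖circleSeries U t‖ ^ 2 ∂haarAddCircle ≤
      ∫ t : AddCircle (2 * Real.pi), ‖F.eval ((r : ℂ) * fourier 1 t)‖ ∂haarAddCircle := by
    rw [← hVint]
    refine integral_mono (hint hU) (hint hV) fun t => ?_
    simp only [hUeq, hVeq, Pi.mul_apply, norm_mul]
    gcongr
    exact mul_le_of_le_one_left (norm_nonneg _) (hB1 _ (hmem t))
  have key := h.sum_norm_cauchyProduct_mul_le ⟨U, memℓp_two_of_summable_norm hU⟩
    ⟨V, memℓp_two_of_summable_norm hV⟩ M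
  rw [norm_lp_two_eq_sqrt_integral hU, norm_lp_two_eq_sqrt_integral hV, hVint] at key
  have hI : 0 ≤ ∫ t : AddCircle (2 * Real.pi), ‖F.eval ((r : ℂ) * fourier 1 t)‖ ∂haarAddCircle :=
    integral_nonneg fun t => norm_nonneg _
  calc _ = ∑ n ∈ Finset.range M,
        ‖(∑ q ∈ Finset.HasAntidiagonal.antidiagonal n, U q.1 * V q.2) * c n‖ :=
        Finset.sum_congr rfl fun n _ => by rw [← congrFun hcoeff n]
    _ ≤ _ := key
    _ ≤ C * xNorm c * (Real.sqrt (∫ t : AddCircle (2 * Real.pi), ‖F.eval ((r : ℂ) * fourier 1 t)‖ ∂haarAddCircle) *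
          Real.sqrt (∫ t : AddCircle (2 * Real.pi), ‖F.eval ((r : ℂ) * fourier 1 t)‖ ∂haarAddCircle)) := by
        rw [mul_assoc (C * xNorm c)]
        have := h.mul_xNorm_nonneg
        gcongr
    _ = _ := by rw [Real.mul_self_sqrt hI]

/-- The limit `r → 1` of the inequality for dilates; `|F| = |p|` on the unit circle. -/
theorem HilbertInequality.sum_polynomial_le {c : ℕ → ℂ} {C : ℝ} (h : HilbertInequality c C)
    (p : Polynomial ℂ) (M : ℕ) :
    ∑ n ∈ Finset.range M, ‖p.coeff n * c n‖ ≤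
      C * xNorm c * ∫ t, ‖p.eval (fourier 1 t : ℂ)‖ ∂(haarAddCircle (T := 2 * Real.pi)) := by
  obtain ⟨F, B, G, hB, hG, hB1, hFG, hpF, hn⟩ := hasRieszFactorization p
  have hcont : Continuous fun r : ℝ =>
      ∫ t, ‖F.eval ((r : ℂ) * fourier 1 t)‖ ∂(haarAddCircle (T := 2 * Real.pi)) := by
    have := continuous_parametric_integral_of_continuous
      (μ := haarAddCircle (T := 2 * Real.pi)) (s := Set.univ)
      (f := fun (r : ℝ) (t : AddCircle (2 * Real.pi)) => ‖F.eval ((r : ℂ) * fourier 1 t)‖)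
      (by
        refine Continuous.norm (F.continuous.comp ?_)
        exact (Complex.continuous_ofReal.comp continuous_fst).mul
          ((fourier 1).continuous.comp continuous_snd)) isCompact_univ
    simpa only [Measure.restrict_univ] using this
  have hlim : Filter.Tendsto (fun r : ℝ => ∑ n ∈ Finset.range M, ‖p.coeff n * (r : ℂ) ^ n * c n‖)
      (nhdsWithin 1 (Set.Iio 1)) (nhds (∑ n ∈ Finset.range M, ‖p.coeff n * c n‖)) := by
    have : Continuous fun r : ℝ => ∑ n ∈ Finset.range M, ‖p.coeff n * (r : ℂ) ^ n * c n‖ := by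
      fun_prop
    simpa using (this.tendsto 1).mono_left nhdsWithin_le_nhds
  have hlim' := ((hcont.tendsto 1).mono_left
    (nhdsWithin_le_nhds (s := Set.Iio (1 : ℝ)))).const_mul (C * xNorm c)
  refine (le_of_tendsto_of_tendsto hlim hlim' ?_).trans_eq ?_
  · filter_upwards [Ioo_mem_nhdsLT (zero_lt_one' ℝ)] with r hr
    exact h.sum_dilate_le hB hG hB1 hFG hpF hr.1.le hr.2 M
  · congr 1
    refine integral_congr_ae (Filter.Eventually.of_forall fun t => ?_)
    simp only [Complex.ofReal_one, one_mul]
    exact hn _ (norm_fourier_one_apply t)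

/-! ### Fejér means -/

/-- The Fejér kernel `|1 + e^{iu} + ⋯ + e^{i(N-1)u}|² / N`. -/
noncomputable def fejerKernel (N : ℕ) (u : AddCircle (2 * Real.pi)) : ℝ :=
  ‖∑ k ∈ Finset.range N, (fourier 1 u : ℂ) ^ k‖ ^ 2 / N

theorem fejerKernel_nonneg (N : ℕ) (u : AddCircle (2 * Real.pi)) : 0 ≤ fejerKernel N u := by
  unfold fejerKernel
  positivity

theorem continuous_fejerKernel (N : ℕ) : Continuous (fejerKernel N) :=
  (((continuous_finsetSum _ fun k _ => (fourier 1).continuous.pow k).norm).pow 2).div_const _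

theorem integral_fejerKernel {N : ℕ} (hN : N ≠ 0) :
    ∫ u, fejerKernel N u ∂haarAddCircle = 1 := by
  set A : ℕ → ℂ := fun n => if n ∈ Finset.range N then 1 else 0
  have hA0 : ∀ n ∉ Finset.range N, A n = 0 := fun n hn => if_neg hn
  have hA : Summable fun n => ‖A n‖ :=
    summable_of_ne_finset_zero (s := Finset.range N) fun n hn => by rw [hA0 n hn, norm_zero]
  have h := (hasSum_norm_sq_circleSeries hA).tsum_eq
  rw [tsum_eq_sum (s := Finset.range N) fun n hn => by rw [hA0 n hn]; norm_num,
    Finset.sum_congr rfl fun n hn => by rw [show A n = 1 from if_pos hn]] at h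
  have he : ∀ u, circleSeries A u = ∑ k ∈ Finset.range N, (fourier 1 u : ℂ) ^ k := fun u => by
    rw [circleSeries_eq_sum hA0]
    exact Finset.sum_congr rfl fun n hn => by rw [show A n = 1 from if_pos hn, one_mul]
  simp only [he, norm_one, one_pow, Finset.sum_const, Finset.card_range, nsmul_eq_mul,
    mul_one] at h
  unfold fejerKernel
  rw [integral_div, ← h, div_self (by exact_mod_cast hN)]

theorem fejerKernel_eq_sum (N : ℕ) (u : AddCircle (2 * Real.pi)) :
    (fejerKernel N u : ℂ) =
      (∑ j ∈ Finset.range N, ∑ k ∈ Finset.range N, (fourier ((j : ℤ) - k) u : ℂ)) / N := by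
  unfold fejerKernel
  push_cast
  rw [← Complex.mul_conj', map_sum, Finset.sum_mul_sum]
  congr 1
  refine Finset.sum_congr rfl fun j _ => Finset.sum_congr rfl fun k _ => ?_
  rw [sub_eq_add_neg, fourier_add, fourier_neg, fourier_natCast_apply, fourier_natCast_apply]

/-- Summing over the diagonals `j - k = n` of a square, of which the `n`-th has `N - n` entries. -/
theorem sum_sum_sub_eq {φ : ℤ → ℂ} (hφ : ∀ m < 0, φ m = 0) (N : ℕ) :
    ∑ j ∈ Finset.range N, ∑ k ∈ Finset.range N, φ ((j : ℤ) - k) =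
      ∑ n ∈ Finset.range N, ((N : ℂ) - n) * φ n := by
  induction N with
  | zero => simp
  | succ N ih =>
    have h1 : ∑ j ∈ Finset.range N, φ ((j : ℤ) - N) = 0 := Finset.sum_eq_zero fun j hj =>
      hφ _ (by have := Finset.mem_range.mp hj; omega)
    have h2 : ∑ k ∈ Finset.range (N + 1), φ ((N : ℤ) - k) = ∑ n ∈ Finset.range (N + 1), φ n := by
      rw [← Finset.sum_range_reflect]
      refine Finset.sum_congr rfl fun k hk => ?_
      have := Finset.mem_range.mp hk
      congr 1
      omega
    rw [Finset.sum_range_succ, h2]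
    simp only [Finset.sum_range_succ _ N, Finset.sum_add_distrib, h1, ih]
    push_cast
    have h3 : ∑ n ∈ Finset.range N, ((N : ℂ) + 1 - n) * φ n =
        ∑ n ∈ Finset.range N, ((N : ℂ) - n) * φ n + ∑ n ∈ Finset.range N, φ n := by
      rw [← Finset.sum_add_distrib]
      exact Finset.sum_congr rfl fun n _ => by ring
    rw [h3]
    ring

/-- The `N`-th Fejér mean of `f ∈ H^1`, as a polynomial in `z`. -/
noncomputable def fejerPolynomial (f : CircleLp 1) (N : ℕ) : Polynomial ℂ :=
  ∑ n ∈ Finset.range N, Polynomial.monomial n (((N : ℂ) - n) / N * coeff f n)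

theorem coeff_fejerPolynomial (f : CircleLp 1) {N n : ℕ} (h : n < N) :
    (fejerPolynomial f N).coeff n = ((N : ℂ) - n) / N * coeff f n := by
  simp only [fejerPolynomial, Polynomial.finsetSum_coeff, Polynomial.coeff_monomial]
  rw [Finset.sum_ite_eq', if_pos (Finset.mem_range.mpr h)]

theorem eval_fejerPolynomial {f : CircleLp 1} (hf : f ∈ HardySpace 1) (N : ℕ)
    (t : AddCircle (2 * Real.pi)) :
    (fejerPolynomial f N).eval (fourier 1 t : ℂ) =
      ∫ s, fejerKernel N (t - s) * f s ∂haarAddCircle := by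
  have hint : ∀ m : ℤ, Integrable (fun s => (fourier m (t - s) : ℂ) * f s) haarAddCircle ∧
      ∫ s, (fourier m (t - s) : ℂ) * f s ∂haarAddCircle = coeff f m * fourier m t := fun m => by
    have e : (fun s : AddCircle (2 * Real.pi) => (fourier m (t - s) : ℂ) * f s) =
        fun s => (fourier m t : ℂ) * (fourier (-m) s • f s) := funext fun s => by
      have : (fourier m (t - s) : ℂ) = fourier m t * fourier (-m) s := by
        rw [fourier_apply, fourier_apply, fourier_apply, sub_eq_add_neg, smul_add, toCircle_add,
          Circle.coe_mul, smul_neg, neg_smul]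
      rw [this, smul_eq_mul, mul_assoc]
    rw [e]
    refine ⟨(fourierMul_integrable f (-m)).const_mul _, ?_⟩
    rw [integral_const_mul, mul_comm]
    rfl
  have h1 : ∫ s, fejerKernel N (t - s) * f s ∂haarAddCircle =
      (∑ j ∈ Finset.range N, ∑ k ∈ Finset.range N,
        coeff f ((j : ℤ) - k) * (fourier ((j : ℤ) - k) t : ℂ)) / N := by
    simp only [fejerKernel_eq_sum, div_mul_eq_mul_div, Finset.sum_mul]
    rw [integral_div, integral_finsetSum _ fun j _ => integrable_finsetSum _ fun k _ => (hint _).1]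
    congr 1
    refine Finset.sum_congr rfl fun j _ => ?_
    rw [integral_finsetSum _ fun k _ => (hint _).1]
    exact Finset.sum_congr rfl fun k _ => (hint _).2
  rw [h1, sum_sum_sub_eq (φ := fun m => coeff f m * (fourier m t : ℂ)) fun m hm => by
    rw [hf m hm, zero_mul], fejerPolynomial, Polynomial.eval_finsetSum, Finset.sum_div]
  refine Finset.sum_congr rfl fun n _ => ?_
  rw [Polynomial.eval_monomial, fourier_natCast_apply]
  ring

/-- Convolution with the Fejér kernel is a contraction of `L^1`. -/
theorem integral_norm_fejerPolynomial_le {f : CircleLp 1} (hf : f ∈ HardySpace 1) {N : ℕ}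
    (hN : N ≠ 0) :
    ∫ t : AddCircle (2 * Real.pi), ‖(fejerPolynomial f N).eval (fourier 1 t : ℂ)‖
      ∂haarAddCircle ≤ ‖f‖ := by
  set μ : Measure (AddCircle (2 * Real.pi)) := haarAddCircle
  have hprod : Integrable (Function.uncurry fun t s : AddCircle (2 * Real.pi) =>
      fejerKernel N (t - s) * ‖f s‖) (μ.prod μ) := by
    have hcont : Continuous fun x : AddCircle (2 * Real.pi) × AddCircle (2 * Real.pi) =>
        fejerKernel N (x.1 - x.2) :=
      (continuous_fejerKernel N).comp (continuous_fst.sub continuous_snd)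
    obtain ⟨K, hK⟩ := isCompact_univ.exists_bound_of_continuousOn hcont.continuousOn
    exact ((CircleLp.integrable f).norm.comp_snd μ).bdd_mul hcont.aestronglyMeasurable
      (Filter.Eventually.of_forall fun x => hK x (Set.mem_univ x))
  calc _ ≤ ∫ t, ∫ s, fejerKernel N (t - s) * ‖f s‖ ∂μ ∂μ := by
        refine integral_mono ?_ hprod.integral_prod_left fun t => ?_
        · exact ((fejerPolynomial f N).continuous.comp
            (fourier 1).continuous).norm.integrable_of_hasCompactSupport
              (HasCompactSupport.of_compactSpace _)
        · dsimp only
          rw [eval_fejerPolynomial hf]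
          refine (norm_integral_le_integral_norm _).trans_eq ?_
          refine integral_congr_ae (Filter.Eventually.of_forall fun s => ?_)
          dsimp only
          rw [norm_mul, Complex.norm_real, Real.norm_of_nonneg (fejerKernel_nonneg _ _)]
    _ = ∫ s, ∫ t, fejerKernel N (t - s) * ‖f s‖ ∂μ ∂μ := integral_integral_swap hprod
    _ = ∫ s, ‖f s‖ ∂μ := by
        refine integral_congr_ae (Filter.Eventually.of_forall fun s => ?_)
        dsimp only
        rw [integral_mul_const, integral_sub_right_eq_self (fejerKernel N) s,
          integral_fejerKernel hN, one_mul]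
    _ = ‖f‖ := (L1.norm_eq_integral_norm f).symm

/-- The inequality for the Fejér means, in the limit of large degree. -/
theorem HilbertInequality.hardyInequality {c : ℕ → ℂ} {C : ℝ} (h : HilbertInequality c C) :
    HardyInequality c C := by
  intro f hf
  have hM : ∀ M : ℕ, ∑ n ∈ Finset.range M, ‖coeff f n * c n‖ ≤ C * xNorm c * ‖f‖ := by
    intro M
    have hlim : Filter.Tendsto
        (fun N : ℕ => ∑ n ∈ Finset.range M, ‖((N : ℂ) - n) / N * coeff f n * c n‖)
        Filter.atTop (nhds (∑ n ∈ Finset.range M, ‖coeff f n * c n‖)) := by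
      refine tendsto_finsetSum _ fun n _ => ?_
      have h1 : Filter.Tendsto (fun N : ℕ => ((N : ℂ) - n) / N) Filter.atTop (nhds 1) := by
        have h2 : Filter.Tendsto (fun N : ℕ => 1 - (n : ℂ) / N) Filter.atTop (nhds (1 - 0)) :=
          (tendsto_const_div_atTop_nhds_zero_nat (n : ℂ)).const_sub 1
        rw [sub_zero] at h2
        refine h2.congr' ?_
        filter_upwards [Filter.eventually_ne_atTop 0] with N hN
        rw [sub_div, div_self (by exact_mod_cast hN)]
      simpa only [one_mul] using ((h1.mul_const (coeff f n)).mul_const (c n)).norm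
    refine le_of_tendsto hlim ?_
    filter_upwards [Filter.eventually_ge_atTop (M + 1)] with N hN
    calc _ = ∑ n ∈ Finset.range M, ‖(fejerPolynomial f N).coeff n * c n‖ := by
          refine Finset.sum_congr rfl fun n hn => ?_
          rw [coeff_fejerPolynomial f (by have := Finset.mem_range.mp hn; omega)]
      _ ≤ _ := h.sum_polynomial_le _ M
      _ ≤ _ := mul_le_mul_of_nonneg_left (integral_norm_fejerPolynomial_le hf (by omega))
          h.mul_xNorm_nonneg
  exact ⟨summable_of_sum_range_le (fun n => norm_nonneg _) hM,
    Real.tsum_le_of_sum_range_le (fun n => norm_nonneg _) hM⟩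

/-! ### Least constants -/

theorem hardyInequality_iff_hilbertInequality {c : ℕ → ℂ} {C : ℝ} :
    HardyInequality c C ↔ HilbertInequality c C :=
  ⟨HardyInequality.hilbertInequality, HilbertInequality.hardyInequality⟩

theorem isClosed_setOf_hilbertInequality (c : ℕ → ℂ) : IsClosed {B | HilbertInequality c B} := by
  simp only [HilbertInequality, Set.ofPred_forall, Set.ofPred_and]
  refine isClosed_iInter fun a => isClosed_iInter fun b => isClosed_const.inter ?_
  exact isClosed_le continuous_const (by fun_prop)

/-- The admissible constants form a closed set, which is nonempty by the Schur test. Both the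
one-sequence and the uniform least constants are covered by the choice of `S`. -/
theorem exists_isLeast_hilbertInequality {S : Set (ℕ → ℂ)} (hS : S ⊆ SpaceX) :
    ∃ C, IsLeast {B : ℝ | 0 ≤ B ∧ ∀ c ∈ S, HilbertInequality c B} C := by
  refine ⟨_, IsClosed.isLeast_csInf ?_
    ⟨2 * Real.sqrt 6, by positivity, fun c hc => hilbertInequality_of_mem_spaceX (hS hc)⟩
    ⟨0, fun B hB => hB.1⟩⟩
  simp only [Set.ofPred_and, Set.ofPred_forall]
  exact isClosed_Ici.inter (isClosed_iInter fun c => isClosed_iInter fun _ =>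
    isClosed_setOf_hilbertInequality c)

theorem theorem3p5 :
    (∀ c ∈ SpaceX,
      ((∃ A : ℝ, HardyInequality c A) ↔ ∃ B : ℝ, HilbertInequality c B) ∧
      (∀ C : ℝ, HardyInequality c C ↔ HilbertInequality c C) ∧
      ∃ C : ℝ, IsLeast {A : ℝ | 0 ≤ A ∧ HardyInequality c A} C ∧
        IsLeast {B : ℝ | 0 ≤ B ∧ HilbertInequality c B} C) ∧
    ∃ C : ℝ, IsLeast {A : ℝ | 0 ≤ A ∧ ∀ c ∈ SpaceX, HardyInequality c A} C ∧
      IsLeast {B : ℝ | 0 ≤ B ∧ ∀ c ∈ SpaceX, HilbertInequality c B} C := by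
  simp only [hardyInequality_iff_hilbertInequality, and_self, implies_true, true_and]
  refine ⟨fun c hc => ?_, exists_isLeast_hilbertInequality subset_rfl⟩
  simpa using exists_isLeast_hilbertInequality (Set.singleton_subset_iff.mpr hc)
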